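/- Let $n\ge 1$ be an integer and $\Sigma=\{0,1\}$. For $\mathbf{x}=x_1\cdots x_n\in\Sigma^n$ let $\mathcal{B}(\mathbf{x})\subseteq\Sigma^{n-1}$ be the single-deletion single-substitution ball of $\mathbf{x}$, i.e. the set of all sequences obtained from $\mathbf{x}$ by deleting exactly one symbol and then changing at most one symbol. A set $\mathcal{C}\subseteq\Sigma^n$ is an $(n,N;\mathcal{B})$-reconstruction code if $|\mathcal{B}(\mathbf{x})\cap\mathcal{B}(\mathbf{y})|<N$ for any two distinct $\mathbf{x},\mathbf{y}\in\mathcal{C}$; the redundancy of a nonempty $\mathcal{C}$ is $\mathrm{red}(\mathcal{C})=n-\log_2|\mathcal{C}|$. Put $\mathrm{VT}^0(\mathbf{x})=\sum_{i=1}^n x_i$ and $\mathrm{VT}^1(\mathbf{x})=\sum_{i=1}^n i\,x_i$. For integers $s_0\in\{0,1,2,3\}$ and $s_1\in\{0,1,\ldots,2n-1\}$ let \[ \mathcal{C}_1=\mathcal{C}_1(s_0,s_1)=\{\mathbf{x}\in\Sigma^n:\ \mathrm{VT}^0(\mathbf{x})\equiv s_0 \pmod 4,\ \mathrm{VT}^1(\mathbf{x})\equiv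 s_1 \pmod{2n}\}. \] Then, for every such $s_0,s_1$, $\mathcal{C}_1(s_0,s_1)$ is an $(n,14;\mathcal{B})$-reconstruction code, i.e. $|\mathcal{B}(\mathbf{x})\cap\mathcal{B}(\mathbf{y})|\le 13$ for any two distinct $\mathbf{x},\mathbf{y}\in\mathcal{C}_1(s_0,s_1)$. Moreover, there exist $s_0\in\{0,1,2,3\}$ and $s_1\in\{0,1,\ldots,2n-1\}$ such that $\mathcal{C}_1(s_0,s_1)$ is nonempty and $\mathrm{red}(\mathcal{C}_1(s_0,s_1))\le\log_2 n+3$. -/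

import Mathlib

namespace DelSub

/-- Binary sequences of length `n`. The entry written `x_i` with `1 ≤ i ≤ n` is `x ⟨i - 1, _⟩`. -/
abbrev BinSeq (n : ℕ) : Type := Fin n → Fin 2

/-- The single-deletion ball: all subsequences of `x` of length `n - 1`. -/
def deletionBall {n : ℕ} (x : BinSeq n) : Set (BinSeq (n - 1)) :=
  {y | ∃ f : Fin (n - 1) → Fin n, StrictMono f ∧ y = x ∘ f}

/-- The single-substitution ball: all sequences at Hamming distance at most one from `x`. -/
def substitutionBall {n : ℕ} (x : BinSeq n) : Set (BinSeq n) :=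
  {y | hammingDist x y ≤ 1}

/-- The single-deletion single-substitution ball: all sequences obtainable from `x` by
one deletion and (at most) one substitution. -/
def delSubBall {n : ℕ} (x : BinSeq n) : Set (BinSeq (n - 1)) :=
  {z | ∃ y ∈ deletionBall x, z ∈ substitutionBall y}

/-- `C` is an `(n, N; B)`-reconstruction code, `B` being the single-deletion
single-substitution ball. -/
def IsReconstructionCode {n : ℕ} (N : ℕ) (C : Set (BinSeq n)) : Prop :=
  ∀ x ∈ C, ∀ y ∈ C, x ≠ y → (delSubBall x ∩ delSubBall y).ncard < N

/-- The redundancy `n - log₂ |C|` of a (nonempty) code. -/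
noncomputable def redundancy {n : ℕ} (C : Set (BinSeq n)) : ℝ :=
  (n : ℝ) - Real.logb 2 (C.ncard : ℝ)

/-- The weight: the number of ones. -/
def weight {n : ℕ} (x : BinSeq n) : ℕ := ∑ i : Fin n, (x i : ℕ)

/-- The `k`-th order VT syndrome: the weight for `k = 0`, and
`∑_{i=1}^n ∑_{j=1}^i j^(k-1) x_i` for `k ≥ 1`. -/
def vtSyndrome {n : ℕ} : ℕ → BinSeq n → ℕ
  | 0, x => weight x
  | k + 1, x => ∑ i : Fin n, ∑ j ∈ Finset.Icc 1 ((i : ℕ) + 1), j ^ k * (x i : ℕ)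

/-- The code of all sequences of length `n` with zeroth order VT syndrome congruent to `s₀`
modulo `4` and first order VT syndrome congruent to `s₁` modulo `2n`. -/
def codeC1 (n s₀ s₁ : ℕ) : Set (BinSeq n) :=
  {x | vtSyndrome 0 x ≡ s₀ [MOD 4] ∧ vtSyndrome 1 x ≡ s₁ [MOD 2 * n]}

end DelSub

/-!
A common element of the two balls arises by deleting position `i` of `x`, position `j` of `y` and
then substituting at most one symbol in each. Continuing all sequences by zeros, its existence
bounds the differences of weights and first moments, so the congruences modulo `4` and `2n` become
equalities. Then `x ≠ y` differ in at least four positions; let `p₁ < p₂ < p₃` be the first three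
and `q₃ < q₂ < q₁` the last three.

Say `i ≤ j`. The two deletions may disagree in at most two places, whereas each difference of `x`
and `y` outside `[i, j]`, and each *mismatch* `x (m + 1) ≠ y m` with `i ≤ m < j`, is a
disagreement. Equality of first moments provides a mismatch in `[p₂, q₂)`, which forces `i ≤ p₁` or
`q₁ ≤ j` and leaves at most `8`, `6` or `5` common sequences according as `[p₁, q₁)` contains one,
two or more mismatches. The numbers of mismatches for `(x, y)` and `(y, x)` have the same parity, so
the two orders together give at most `13`, except when both numbers are one. In that case the
positions of the two mismatches make candidates coincide, which again leaves `13`.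

The `8n` codes partition the cube, so one of them has at least `2 ^ n / (8n)` elements.
-/

namespace DelSub

theorem encard_setOf_mem_list_le {α : Type*} (l : List α) : {a | a ∈ l}.encard ≤ l.length := by
  classical
  rw [show {a | a ∈ l} = (l.toFinset : Set α) by ext; simp, Set.encard_coe_eq_coe_finsetCard]
  exact_mod_cast l.toFinset_card_le

theorem encard_union_add_one_le {α : Type*} {S T : Set α} (hST : (S ∩ T).Nonempty) :
    (S ∪ T).encard + 1 ≤ S.encard + T.encard := by
  rw [← Set.encard_union_add_encard_inter S T]
  gcongr
  exact Set.one_le_encard_iff_nonempty.2 hST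

section Near

variable {ι : Type*} {W W₁ W₂ Z : ι → Bool} {a b : ι}

/-- `Z` and `W` are at Hamming distance at most one. -/
def Near (Z W : ι → Bool) : Prop := ∃ t, ∀ m, m ≠ t → Z m = W m

/-- The substitution at position `t`. -/
def flipAt [DecidableEq ι] (Z : ι → Bool) (t : ι) : ι → Bool := Function.update Z t (!Z t)

theorem eq_flipAt [DecidableEq ι] (h : ∀ m, m ≠ a → Z m = W m) (ha : Z a ≠ W a) :
    Z = flipAt W a := by
  refine Function.eq_update_iff.2 ⟨?_, h⟩
  simpa [Bool.eq_not] using ha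

theorem flipAt_eq_flipAt [DecidableEq ι] {U V : ι → Bool} (hab : a ≠ b)
    (ha : U a ≠ V a) (hb : U b ≠ V b) (h : ∀ m, m ≠ a → m ≠ b → U m = V m) :
    flipAt U a = flipAt V b := by
  refine eq_flipAt (fun m hmb => ?_) ?_
  · rcases eq_or_ne m a with rfl | hma
    · simpa [flipAt] using Bool.not_eq.2 ha
    · simpa [flipAt, hma] using h m hma hmb
  · simpa [flipAt, hab.symm] using hb

theorem Near.eqOn_compl_pair (h₁ : Near Z W₁) (h₂ : Near Z W₂) (hab : a ≠ b)
    (ha : W₁ a ≠ W₂ a) (hb : W₁ b ≠ W₂ b) {m : ι} (hma : m ≠ a) (hmb : m ≠ b) : W₁ m = W₂ m := by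
  obtain ⟨s, hs⟩ := h₁
  obtain ⟨t, ht⟩ := h₂
  by_cases hms : m = s <;> by_cases hmt : m = t <;> grind

theorem Near.eq_flipAt_or_eq_flipAt [DecidableEq ι] (h₁ : Near Z W₁) (h₂ : Near Z W₂)
    (hab : a ≠ b) (ha : W₁ a ≠ W₂ a) (hb : W₁ b ≠ W₂ b) : Z = flipAt W₂ a ∨ Z = flipAt W₂ b := by
  obtain ⟨s, hs⟩ := h₁
  obtain ⟨t, ht⟩ := h₂
  have ht_mem : t = a ∨ t = b := by grind
  rcases ht_mem with rfl | rfl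
  · exact .inl (eq_flipAt ht (by grind))
  · exact .inr (eq_flipAt ht (by grind))

theorem Near.eq_or_eq (h₁ : Near Z W₁) (h₂ : Near Z W₂) (ha : W₁ a ≠ W₂ a)
    (h : ∀ m, m ≠ a → W₁ m = W₂ m) : Z = W₁ ∨ Z = W₂ := by
  obtain ⟨s, hs⟩ := h₁
  obtain ⟨t, ht⟩ := h₂
  have hZ : Z a = W₁ a ∨ Z a = W₂ a := (eq_or_ne (Z a) (W₁ a)).imp_right fun hne =>
    (Bool.eq_not.2 hne).trans (Bool.eq_not.2 ha.symm).symm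
  rcases hZ with hZ | hZ
  · exact .inl (funext fun m => by by_cases m = a <;> by_cases m = s <;> grind)
  · exact .inr (funext fun m => by by_cases m = a <;> by_cases m = t <;> grind)

end Near

section Deletion

/-- The deletion of the entry at position `i` of an infinite sequence. -/
def del {α : Type*} (i : ℕ) (X : ℕ → α) : ℕ → α := fun m => if m < i then X m else X (m + 1)

variable {α : Type*} {X Y : ℕ → α} {i j m : ℕ}

theorem del_of_lt (h : m < i) : del i X m = X m := if_pos h

theorem del_of_le (h : i ≤ m) : del i X m = X (m + 1) := if_neg h.not_gt

theorem del_sub_one_of_lt (h : i < m) : del i X (m - 1) = X m := by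
  rw [del_of_le (by lia), Nat.sub_add_cancel (by lia)]

theorem del_eq_del_of_const (hij : i ≤ j) (h : ∀ m, i ≤ m → m < j → X m = X (m + 1)) :
    del i X = del j X := by
  funext m
  simp only [del]
  grind

theorem del_ne_del_of_lt (hij : i ≤ j) (hm : m < i) (h : X m ≠ Y m) : del i X m ≠ del j Y m := by
  rwa [del_of_lt hm, del_of_lt (by lia)]

theorem del_ne_del_of_gt (hij : i ≤ j) (hm : j < m) (h : X m ≠ Y m) :
    del i X (m - 1) ≠ del j Y (m - 1) := by
  rwa [del_sub_one_of_lt hm, del_sub_one_of_lt (by lia)]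

theorem del_eq_del_iff (hi : i ≤ m) (hj : m < j) : del i X m = del j Y m ↔ X (m + 1) = Y m := by
  rw [del_of_le hi, del_of_lt hj]

end Deletion

section Mismatches

variable {X Y Z : ℕ → Bool} {i j k p q : ℕ}

/-- The positions in `[p, q)` at which `X`, shifted by one, disagrees with `Y`; these are the
disagreements of `del p X` and `del q Y` between `p` and `q`. -/
def mismatches (X Y : ℕ → Bool) (p q : ℕ) : Finset ℕ :=
  (Finset.Ico p q).filter fun k => X (k + 1) ≠ Y k

theorem mem_mismatches : k ∈ mismatches X Y p q ↔ (p ≤ k ∧ k < q) ∧ X (k + 1) ≠ Y k := by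
  simp [mismatches]

theorem mismatches_eq_empty :
    mismatches X Y p q = ∅ ↔ ∀ k, p ≤ k → k < q → X (k + 1) = Y k := by
  simp [mismatches, Finset.filter_eq_empty_iff]

theorem card_mismatches_add {r : ℕ} (hpq : p ≤ q) (hqr : q ≤ r) :
    (mismatches X Y p q).card + (mismatches X Y q r).card = (mismatches X Y p r).card := by
  rw [mismatches, mismatches, mismatches, ← Finset.Ico_union_Ico_eq_Ico hpq hqr,
    Finset.filter_union, Finset.card_union_of_disjoint]
  exact Finset.disjoint_filter_filter (Finset.Ico_disjoint_Ico_consecutive p q r)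

theorem mismatches_subset {p' q' : ℕ} (hp : p' ≤ p) (hq : q ≤ q') :
    mismatches X Y p q ⊆ mismatches X Y p' q' :=
  Finset.filter_subset_filter _ (Finset.Ico_subset_Ico hp hq)

theorem del_ne_del_of_mem_mismatches (hk : k ∈ mismatches X Y i j) : del i X k ≠ del j Y k := by
  obtain ⟨⟨hi, hj⟩, h⟩ := mem_mismatches.1 hk
  rwa [ne_eq, del_eq_del_iff hi hj]

theorem Near.card_mismatches_le_two (hX : Near Z (del i X)) (hY : Near Z (del j Y)) :
    (mismatches X Y i j).card ≤ 2 := by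
  by_contra! hcard
  obtain ⟨a, ha, b, hb, c, hc, hab, hac, hbc⟩ := Finset.two_lt_card.1 hcard
  exact del_ne_del_of_mem_mismatches hc <|
    hX.eqOn_compl_pair hY hab (del_ne_del_of_mem_mismatches ha) (del_ne_del_of_mem_mismatches hb)
      hac.symm hbc.symm

/-- The sequences obtained from both `X` and `Y` by a deletion and at most one substitution, the
symbol of `X` being deleted no later than that of `Y`. -/
def orderedCommon (X Y : ℕ → Bool) : Set (ℕ → Bool) :=
  {Z | ∃ i j, i ≤ j ∧ Near Z (del i X) ∧ Near Z (del j Y)}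

end Mismatches

/-- `p₁ < p₂ < p₃` are the first three and `q₃ < q₂ < q₁` the last three positions where `X` and
`Y` differ, and there are at least four such positions. -/
structure Window (X Y : ℕ → Bool) (p₁ p₂ p₃ q₃ q₂ q₁ : ℕ) : Prop where
  lt_p₂ : p₁ < p₂
  lt_p₃ : p₂ < p₃
  lt_q₂ : q₃ < q₂
  lt_q₁ : q₂ < q₁
  p₂_le_q₃ : p₂ ≤ q₃
  p₃_le_q₂ : p₃ ≤ q₂
  ne_p₁ : X p₁ ≠ Y p₁
  ne_p₂ : X p₂ ≠ Y p₂
  ne_p₃ : X p₃ ≠ Y p₃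
  ne_q₃ : X q₃ ≠ Y q₃
  ne_q₂ : X q₂ ≠ Y q₂
  ne_q₁ : X q₁ ≠ Y q₁
  of_ne_left : ∀ m, X m ≠ Y m → m = p₁ ∨ m = p₂ ∨ p₃ ≤ m
  of_ne_right : ∀ m, X m ≠ Y m → m = q₁ ∨ m = q₂ ∨ m ≤ q₃

namespace Window

variable {X Y Z : ℕ → Bool} {p₁ p₂ p₃ q₃ q₂ q₁ i j m τ : ℕ}

theorem symm (w : Window X Y p₁ p₂ p₃ q₃ q₂ q₁) : Window Y X p₁ p₂ p₃ q₃ q₂ q₁ :=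
  { w with
    ne_p₁ := w.ne_p₁.symm
    ne_p₂ := w.ne_p₂.symm
    ne_p₃ := w.ne_p₃.symm
    ne_q₃ := w.ne_q₃.symm
    ne_q₂ := w.ne_q₂.symm
    ne_q₁ := w.ne_q₁.symm
    of_ne_left := fun m h => w.of_ne_left m h.symm
    of_ne_right := fun m h => w.of_ne_right m h.symm }

section Endpoints

variable (w : Window X Y p₁ p₂ p₃ q₃ q₂ q₁)
include w

theorem p₁_lt_q₁ : p₁ < q₁ := by
  have := w.lt_p₂; have := w.lt_p₃; have := w.p₃_le_q₂; have := w.lt_q₁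
  lia

theorem eq_of_lt (hm : m < p₁) : X m = Y m := by
  by_contra h
  have := w.of_ne_left m h; have := w.lt_p₂; have := w.lt_p₃
  lia

theorem eq_of_gt (hm : q₁ < m) : X m = Y m := by
  by_contra h
  have := w.of_ne_right m h; have := w.lt_q₁; have := w.lt_q₂
  lia

theorem del_eq_del_p₁ (hi : i ≤ p₁) (h : mismatches X Y i p₁ = ∅) : del i X = del p₁ X :=
  del_eq_del_of_const hi fun m him hm =>
    (w.eq_of_lt hm).trans (mismatches_eq_empty.1 h m him hm).symm

theorem del_eq_del_q₁ (hj : q₁ ≤ j) (h : mismatches X Y q₁ j = ∅) : del j Y = del q₁ Y :=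
  (del_eq_del_of_const hj fun m hm hmj =>
    (mismatches_eq_empty.1 h m hm hmj).symm.trans (w.eq_of_gt (Nat.lt_succ_of_le hm))).symm

theorem del_eq_del_of_notMem_mismatches (hm : m ∉ mismatches X Y p₁ q₁) :
    del p₁ X m = del q₁ Y m := by
  have := w.p₁_lt_q₁; have := w.eq_of_lt (m := m); have := w.eq_of_gt (m := m + 1)
  simp only [del, mem_mismatches] at hm ⊢
  grind

theorem tail_cases (hM : (mismatches X Y p₂ q₂).Nonempty) (hij : i ≤ j) (hi : p₁ < i)
    (hj : q₁ ≤ j) (hX : Near Z (del i X)) (hY : Near Z (del j Y)) :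
    Z = flipAt (del q₁ Y) p₁ ∨ (mismatches X Y p₃ q₁ = ∅ ∧ Z = flipAt (del q₁ Y) p₂) ∨
      ∃ τ, mismatches X Y p₂ q₁ = {τ} ∧ Z = flipAt (del q₁ Y) τ := by
  obtain ⟨τ, hτ⟩ := hM
  have ⟨⟨hpτ, hτq⟩, hτne⟩ := mem_mismatches.1 hτ
  have := w.lt_p₂; have := w.lt_p₃; have := w.lt_q₁; have := w.p₃_le_q₂
  have ne₁ := del_ne_del_of_lt hij hi w.ne_p₁
  rcases le_or_gt i p₂ with hi₂ | hi₂
  · have neτ : del i X τ ≠ del j Y τ :=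
      del_ne_del_of_mem_mismatches (mismatches_subset hi₂ (by lia) hτ)
    have shift : ∀ m, i ≤ m → m < j → m ≠ τ → X (m + 1) = Y m := fun m him hmj hm =>
      (del_eq_del_iff him hmj).1 (hX.eqOn_compl_pair hY (by lia) ne₁ neτ (by lia) hm)
    have hZ := hX.eq_flipAt_or_eq_flipAt hY (by lia) ne₁ neτ
    rw [w.del_eq_del_q₁ hj <| mismatches_eq_empty.2 fun m hm hmj =>
      shift m (by lia) hmj (by lia)] at hZ
    have hMτ : mismatches X Y p₂ q₁ = {τ} := by
      ext m
      grind [mem_mismatches]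
    exact hZ.imp_right fun hZ => .inr ⟨τ, hMτ, hZ⟩
  · have ne₂ := del_ne_del_of_lt hij hi₂ w.ne_p₂
    have agree : ∀ m, m ≠ p₁ → m ≠ p₂ → del i X m = del j Y m := fun m =>
      hX.eqOn_compl_pair hY (by lia) ne₁ ne₂
    have hi₃ : i ≤ p₃ := by
      by_contra! hlt
      exact del_ne_del_of_lt hij hlt w.ne_p₃ (agree p₃ (by lia) (by lia))
    have shift : ∀ m, p₃ ≤ m → m < j → X (m + 1) = Y m := fun m hm hmj =>
      (del_eq_del_iff (by lia) hmj).1 (agree m (by lia) (by lia))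
    have hZ := hX.eq_flipAt_or_eq_flipAt hY (by lia) ne₁ ne₂
    rw [w.del_eq_del_q₁ hj <| mismatches_eq_empty.2 fun m hm hmj => shift m (by lia) hmj] at hZ
    have hM₃ : mismatches X Y p₃ q₁ = ∅ :=
      mismatches_eq_empty.2 fun m hm hmq => shift m hm (by lia)
    exact hZ.imp_right fun hZ => .inl ⟨hM₃, hZ⟩

theorem head_cases (hM : (mismatches X Y p₂ q₂).Nonempty) (hij : i ≤ j) (hi : i ≤ p₁)
    (hj : j < q₁) (hX : Near Z (del i X)) (hY : Near Z (del j Y)) :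
    Z = flipAt (del p₁ X) (q₁ - 1) ∨
      (mismatches X Y p₁ q₃ = ∅ ∧ Z = flipAt (del p₁ X) (q₂ - 1)) ∨
      ∃ τ, mismatches X Y p₁ q₂ = {τ} ∧ Z = flipAt (del p₁ X) τ := by
  obtain ⟨τ, hτ⟩ := hM
  have ⟨⟨hpτ, hτq⟩, hτne⟩ := mem_mismatches.1 hτ
  have := w.lt_p₂; have := w.lt_q₂; have := w.lt_q₁; have := w.p₂_le_q₃
  have ne₁ := del_ne_del_of_gt hij hj w.ne_q₁
  rcases le_or_gt q₂ j with hj₂ | hj₂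
  · have neτ : del i X τ ≠ del j Y τ :=
      del_ne_del_of_mem_mismatches (mismatches_subset (by lia) hj₂ hτ)
    have shift : ∀ m, i ≤ m → m < q₂ → m ≠ τ → X (m + 1) = Y m := fun m him hmj hm =>
      (del_eq_del_iff him (by lia)).1 (hX.eqOn_compl_pair hY (by lia) ne₁ neτ (by lia) hm)
    have hZ := hY.eq_flipAt_or_eq_flipAt hX (by lia) ne₁.symm neτ.symm
    rw [w.del_eq_del_p₁ hi <| mismatches_eq_empty.2 fun m him hm =>
      shift m him (by lia) (by lia)] at hZ
    have hMτ : mismatches X Y p₁ q₂ = {τ} := by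
      ext m
      grind [mem_mismatches]
    exact hZ.imp_right fun hZ => .inr ⟨τ, hMτ, hZ⟩
  · have ne₂ := del_ne_del_of_gt hij hj₂ w.ne_q₂
    have agree : ∀ m, m ≠ q₁ - 1 → m ≠ q₂ - 1 → del i X m = del j Y m := fun m =>
      hX.eqOn_compl_pair hY (by lia) ne₁ ne₂
    have hj₃ : q₃ ≤ j := by
      by_contra! hlt
      exact del_ne_del_of_gt hij hlt w.ne_q₃ (agree _ (by lia) (by lia))
    have shift : ∀ m, i ≤ m → m < q₃ → X (m + 1) = Y m := fun m him hm =>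
      (del_eq_del_iff him (by lia)).1 (agree m (by lia) (by lia))
    have hZ := hY.eq_flipAt_or_eq_flipAt hX (by lia) ne₁.symm ne₂.symm
    rw [w.del_eq_del_p₁ hi <| mismatches_eq_empty.2 fun m him hm => shift m him (by lia)] at hZ
    have hM₃ : mismatches X Y p₁ q₃ = ∅ :=
      mismatches_eq_empty.2 fun m hm hmq => shift m (by lia) hmq
    exact hZ.imp_right fun hZ => .inl ⟨hM₃, hZ⟩

theorem not_near_of_inner (hM : (mismatches X Y p₂ q₂).Nonempty) (hij : i ≤ j) (hi : p₁ < i)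
    (hj : j < q₁) (hX : Near Z (del i X)) : ¬ Near Z (del j Y) := by
  intro hY
  obtain ⟨τ, hτ⟩ := hM
  have ⟨hpτ, hτq⟩ := (mem_mismatches.1 hτ).1
  have := w.lt_p₂; have := w.lt_q₁; have := w.lt_q₂; have := w.p₂_le_q₃
  have agree : ∀ m, m ≠ p₁ → m ≠ q₁ - 1 → del i X m = del j Y m := fun m =>
    hX.eqOn_compl_pair hY (by lia) (del_ne_del_of_lt hij hi w.ne_p₁)
      (del_ne_del_of_gt hij hj w.ne_q₁)
  have hi₂ : i ≤ p₂ := by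
    by_contra! hlt
    exact del_ne_del_of_lt hij hlt w.ne_p₂ (agree p₂ (by lia) (by lia))
  have hj₂ : q₂ ≤ j := by
    by_contra! hlt
    exact del_ne_del_of_gt hij hlt w.ne_q₂ (agree _ (by lia) (by lia))
  exact del_ne_del_of_mem_mismatches (mismatches_subset hi₂ hj₂ hτ) (agree τ (by lia) (by lia))

end Endpoints

theorem cases_of_mem_orderedCommon (w : Window X Y p₁ p₂ p₃ q₃ q₂ q₁)
    (hM : (mismatches X Y p₂ q₂).Nonempty) (hZ : Z ∈ orderedCommon X Y) :
    (∃ i j, i ≤ p₁ ∧ q₁ ≤ j ∧ Near Z (del i X) ∧ Near Z (del j Y)) ∨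
      (Z = flipAt (del q₁ Y) p₁ ∨ (mismatches X Y p₃ q₁ = ∅ ∧ Z = flipAt (del q₁ Y) p₂) ∨
        ∃ τ, mismatches X Y p₂ q₁ = {τ} ∧ Z = flipAt (del q₁ Y) τ) ∨
      Z = flipAt (del p₁ X) (q₁ - 1) ∨
        (mismatches X Y p₁ q₃ = ∅ ∧ Z = flipAt (del p₁ X) (q₂ - 1)) ∨
        ∃ τ, mismatches X Y p₁ q₂ = {τ} ∧ Z = flipAt (del p₁ X) τ := by
  obtain ⟨i, j, hij, hX, hY⟩ := hZ
  rcases le_or_gt i p₁ with hi | hi <;> rcases le_or_gt q₁ j with hj | hj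
  · exact .inl ⟨i, j, hi, hj, hX, hY⟩
  · exact .inr <| .inr <| w.head_cases hM hij hi hj hX hY
  · exact .inr <| .inl <| w.tail_cases hM hij hi hj hX hY
  · exact (w.not_near_of_inner hM hij hi hj hX hY).elim

theorem card_mismatches_add_add_le (w : Window X Y p₁ p₂ p₃ q₃ q₂ q₁) (hi : i ≤ p₁) (hj : q₁ ≤ j)
    (hX : Near Z (del i X)) (hY : Near Z (del j Y)) :
    (mismatches X Y i p₁).card + (mismatches X Y p₁ q₁).card + (mismatches X Y q₁ j).card ≤ 2 := by
  rw [card_mismatches_add hi w.p₁_lt_q₁.le, card_mismatches_add (hi.trans w.p₁_lt_q₁.le) hj]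
  exact hX.card_mismatches_le_two hY

theorem card_mismatches_eq_one_of_singletons (w : Window X Y p₁ p₂ p₃ q₃ q₂ q₁)
    (hM : (mismatches X Y p₂ q₂).Nonempty) {σ : ℕ} (hτ : mismatches X Y p₂ q₁ = {τ})
    (hσ : mismatches X Y p₁ q₂ = {σ}) : (mismatches X Y p₁ q₁).card = 1 := by
  have hpq : p₂ ≤ q₂ := w.p₂_le_q₃.trans w.lt_q₂.le
  have hsplit := card_mismatches_add (X := X) (Y := Y) w.lt_p₂.le hpq
  have hsplit' := card_mismatches_add (X := X) (Y := Y) hpq w.lt_q₁.le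
  have hsplit'' := card_mismatches_add (X := X) (Y := Y) (w.lt_p₂.le.trans hpq) w.lt_q₁.le
  rw [hσ, Finset.card_singleton] at hsplit hsplit''
  rw [hτ, Finset.card_singleton] at hsplit'
  have := hM.card_pos
  lia

theorem encard_orderedCommon_le_five (w : Window X Y p₁ p₂ p₃ q₃ q₂ q₁)
    (hM : (mismatches X Y p₂ q₂).Nonempty) (hcard : 3 ≤ (mismatches X Y p₁ q₁).card) :
    (orderedCommon X Y).encard ≤ 5 := by
  set S := {Z | (∃ τ, mismatches X Y p₂ q₁ = {τ} ∧ Z = flipAt (del q₁ Y) τ) ∨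
    ∃ τ, mismatches X Y p₁ q₂ = {τ} ∧ Z = flipAt (del p₁ X) τ} with hS
  have hS_le : S.encard ≤ 1 := by
    refine Set.encard_le_one_iff.2 ?_
    rintro Z Z' (⟨τ, hτ, rfl⟩ | ⟨τ, hτ, rfl⟩) (⟨σ, hσ, rfl⟩ | ⟨σ, hσ, rfl⟩)
    · rw [Finset.singleton_injective (hτ.symm.trans hσ)]
    · have := w.card_mismatches_eq_one_of_singletons hM hτ hσ
      lia
    · have := w.card_mismatches_eq_one_of_singletons hM hσ hτ
      lia
    · rw [Finset.singleton_injective (hτ.symm.trans hσ)]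
  have hsub : orderedCommon X Y ⊆ {Z | Z ∈ [flipAt (del q₁ Y) p₁, flipAt (del q₁ Y) p₂,
      flipAt (del p₁ X) (q₁ - 1), flipAt (del p₁ X) (q₂ - 1)]} ∪ S := by
    intro Z hZ
    rcases w.cases_of_mem_orderedCommon hM hZ with ⟨i, j, hi, hj, hX, hY⟩ | hZ
    · have := w.card_mismatches_add_add_le hi hj hX hY
      lia
    · simp only [hS, Set.mem_union, Set.mem_ofPred_eq, List.mem_cons, List.not_mem_nil]
      grind only
  calc (orderedCommon X Y).encard
      ≤ _ + S.encard := (Set.encard_le_encard hsub).trans (Set.encard_union_le _ _)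
    _ ≤ 4 + 1 := add_le_add (encard_setOf_mem_list_le _) hS_le
    _ = 5 := by norm_num

theorem encard_orderedCommon_le_six (w : Window X Y p₁ p₂ p₃ q₃ q₂ q₁)
    (hM : (mismatches X Y p₂ q₂).Nonempty) (hcard : (mismatches X Y p₁ q₁).card = 2) :
    (orderedCommon X Y).encard ≤ 6 := by
  obtain ⟨a, b, hab, hMab⟩ := Finset.card_eq_two.1 hcard
  have ha : del p₁ X a ≠ del q₁ Y a := del_ne_del_of_mem_mismatches (by simp [hMab])
  have hb : del p₁ X b ≠ del q₁ Y b := del_ne_del_of_mem_mismatches (by simp [hMab])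
  have agree : ∀ m, m ≠ a → m ≠ b → del p₁ X m = del q₁ Y m := fun m hma hmb =>
    w.del_eq_del_of_notMem_mismatches (by simp [hMab, hma, hmb])
  have := w.lt_p₂; have := w.lt_q₁
  have hsub : orderedCommon X Y ⊆ {Z | Z ∈ [flipAt (del q₁ Y) a, flipAt (del q₁ Y) b,
      flipAt (del q₁ Y) p₁, flipAt (del q₁ Y) p₂, flipAt (del p₁ X) (q₁ - 1),
      flipAt (del p₁ X) (q₂ - 1)]} := by
    intro Z hZ
    simp only [Set.mem_ofPred_eq, List.mem_cons, List.not_mem_nil, or_false]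
    rcases w.cases_of_mem_orderedCommon hM hZ with ⟨i, j, hi, hj, hX, hY⟩ |
      (hZ | ⟨-, hZ⟩ | ⟨τ, hτ, hZ⟩) | (hZ | ⟨-, hZ⟩ | ⟨τ, hτ, hZ⟩)
    · have hle := w.card_mismatches_add_add_le hi hj hX hY
      have hi₀ : mismatches X Y i p₁ = ∅ := Finset.card_eq_zero.1 (by lia)
      have hj₀ : mismatches X Y q₁ j = ∅ := Finset.card_eq_zero.1 (by lia)
      rw [w.del_eq_del_p₁ hi hi₀] at hX
      rw [w.del_eq_del_q₁ hj hj₀] at hY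
      have := hX.eq_flipAt_or_eq_flipAt hY hab ha hb
      tauto
    · tauto
    · tauto
    · have hmem : τ ∈ mismatches X Y p₁ q₁ :=
        mismatches_subset (by lia) le_rfl (hτ ▸ Finset.mem_singleton_self τ)
      rw [hMab, Finset.mem_insert, Finset.mem_singleton] at hmem
      rcases hmem with rfl | rfl <;> tauto
    · tauto
    · tauto
    · have hmem : τ ∈ mismatches X Y p₁ q₁ :=
        mismatches_subset le_rfl (by lia) (hτ ▸ Finset.mem_singleton_self τ)
      rw [hMab, Finset.mem_insert, Finset.mem_singleton] at hmem
      rcases hmem with rfl | rfl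
      · exact .inr (.inl (hZ.trans (flipAt_eq_flipAt hab ha hb agree)))
      · exact .inl (hZ.trans (flipAt_eq_flipAt hab.symm hb ha fun m hm hm' => agree m hm' hm))
  exact (Set.encard_le_encard hsub).trans (encard_setOf_mem_list_le _)

/-- For a single mismatch `τ` in `[p₁, q₁)`: the common sequences obtained by deleting from `X`
before `p₁` and from `Y` after `q₁`, with the substitution outside `[p₁, q₁)`. -/
def outerCandidates (X Y : ℕ → Bool) (p₁ q₁ : ℕ) : Set (ℕ → Bool) :=
  {Z | ∃ i σ, mismatches X Y i p₁ = {σ} ∧ Z = flipAt (del q₁ Y) σ} ∪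
    {Z | ∃ j σ, mismatches X Y q₁ j = {σ} ∧ Z = flipAt (del p₁ X) σ}

/-- For a single mismatch `τ` in `[p₁, q₁)`: `del p₁ X` and the common sequences obtained by
deleting from `X` after `p₁`. -/
def tailCandidates (X Y : ℕ → Bool) (p₁ p₂ p₃ q₁ τ : ℕ) : Set (ℕ → Bool) :=
  {del p₁ X, flipAt (del q₁ Y) p₁} ∪ {Z | τ < p₃ ∧ Z = flipAt (del q₁ Y) p₂}

/-- For a single mismatch `τ` in `[p₁, q₁)`: `del q₁ Y` and the common sequences obtained by
deleting from `Y` before `q₁`. -/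
def headCandidates (X Y : ℕ → Bool) (p₁ q₃ q₂ q₁ τ : ℕ) : Set (ℕ → Bool) :=
  {del q₁ Y, flipAt (del p₁ X) (q₁ - 1)} ∪ {Z | q₃ ≤ τ ∧ Z = flipAt (del p₁ X) (q₂ - 1)}

theorem encard_outerCandidates_le : (outerCandidates X Y p₁ q₁).encard ≤ 2 := by
  refine (Set.encard_union_le _ _).trans ?_
  rw [← one_add_one_eq_two]
  refine add_le_add (Set.encard_le_one_iff.2 ?_) (Set.encard_le_one_iff.2 ?_)
  · rintro Z Z' ⟨i, σ, hσ, rfl⟩ ⟨i', σ', hσ', rfl⟩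
    rcases le_total i i' with h | h
    · have := mismatches_subset (X := X) (Y := Y) h (le_refl p₁)
      simp_all
    · have := mismatches_subset (X := X) (Y := Y) h (le_refl p₁)
      simp_all
  · rintro Z Z' ⟨j, σ, hσ, rfl⟩ ⟨j', σ', hσ', rfl⟩
    rcases le_total j j' with h | h
    · have := mismatches_subset (X := X) (Y := Y) (le_refl q₁) h
      simp_all
    · have := mismatches_subset (X := X) (Y := Y) (le_refl q₁) h
      simp_all

theorem encard_tailCandidates_le_three : (tailCandidates X Y p₁ p₂ p₃ q₁ τ).encard ≤ 3 := by
  have hsub : tailCandidates X Y p₁ p₂ p₃ q₁ τ ⊆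
      {Z | Z ∈ [del p₁ X, flipAt (del q₁ Y) p₁, flipAt (del q₁ Y) p₂]} := by
    intro Z
    simp +contextual [tailCandidates, or_imp]
  exact (Set.encard_le_encard hsub).trans (encard_setOf_mem_list_le _)

theorem encard_headCandidates_le_three : (headCandidates X Y p₁ q₃ q₂ q₁ τ).encard ≤ 3 := by
  have hsub : headCandidates X Y p₁ q₃ q₂ q₁ τ ⊆
      {Z | Z ∈ [del q₁ Y, flipAt (del p₁ X) (q₁ - 1), flipAt (del p₁ X) (q₂ - 1)]} := by
    intro Z
    simp +contextual [headCandidates, or_imp]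
  exact (Set.encard_le_encard hsub).trans (encard_setOf_mem_list_le _)

theorem del_p₁_eq_flipAt (w : Window X Y p₁ p₂ p₃ q₃ q₂ q₁) (hτ : mismatches X Y p₁ q₁ = {τ}) :
    del p₁ X = flipAt (del q₁ Y) τ :=
  eq_flipAt (fun m hm => w.del_eq_del_of_notMem_mismatches (by simpa [hτ] using hm))
    (del_ne_del_of_mem_mismatches (by simp [hτ]))

theorem del_q₁_eq_flipAt (w : Window X Y p₁ p₂ p₃ q₃ q₂ q₁) (hτ : mismatches X Y p₁ q₁ = {τ}) :
    del q₁ Y = flipAt (del p₁ X) τ :=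
  eq_flipAt (fun m hm => (w.del_eq_del_of_notMem_mismatches (by simpa [hτ] using hm)).symm)
    (del_ne_del_of_mem_mismatches (by simp [hτ])).symm

theorem encard_tailCandidates_le_two (w : Window X Y p₁ p₂ p₃ q₃ q₂ q₁)
    (hM : mismatches X Y p₁ q₁ = {τ}) (hτ : p₃ ≤ τ ∨ X τ ≠ Y τ) :
    (tailCandidates X Y p₁ p₂ p₃ q₁ τ).encard ≤ 2 := by
  have hUV := w.del_p₁_eq_flipAt hM
  have hcases : τ = p₁ ∨ τ = p₂ ∨ p₃ ≤ τ := hτ.elim (.inr ∘ .inr) (w.of_ne_left τ)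
  obtain ⟨W, hW⟩ : ∃ W, tailCandidates X Y p₁ p₂ p₃ q₁ τ ⊆ {Z | Z ∈ [del p₁ X, W]} := by
    rcases hcases with rfl | rfl | hlt
    · exact ⟨flipAt (del q₁ Y) p₂, fun Z => by
        simp only [tailCandidates, ← hUV]; simp +contextual [or_imp]⟩
    · exact ⟨flipAt (del q₁ Y) p₁, fun Z => by
        simp only [tailCandidates, ← hUV]; simp +contextual [or_imp]⟩
    · exact ⟨flipAt (del q₁ Y) p₁, fun Z => by simp [tailCandidates, hlt.not_gt]⟩
  exact (Set.encard_le_encard hW).trans (encard_setOf_mem_list_le _)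

theorem encard_headCandidates_le_two (w : Window X Y p₁ p₂ p₃ q₃ q₂ q₁)
    (hM : mismatches X Y p₁ q₁ = {τ}) (hτ : τ < q₃ ∨ X (τ + 1) ≠ Y (τ + 1)) :
    (headCandidates X Y p₁ q₃ q₂ q₁ τ).encard ≤ 2 := by
  have hVU := w.del_q₁_eq_flipAt hM
  have hcases : τ = q₁ - 1 ∨ τ = q₂ - 1 ∨ τ < q₃ := by
    rcases hτ with hτ | hτ
    · exact .inr (.inr hτ)
    · have := w.of_ne_right _ hτ
      lia
  obtain ⟨W, hW⟩ : ∃ W, headCandidates X Y p₁ q₃ q₂ q₁ τ ⊆ {Z | Z ∈ [del q₁ Y, W]} := by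
    rcases hcases with rfl | rfl | hlt
    · exact ⟨flipAt (del p₁ X) (q₂ - 1), fun Z => by
        simp only [headCandidates, ← hVU]; simp +contextual [or_imp]⟩
    · exact ⟨flipAt (del p₁ X) (q₁ - 1), fun Z => by
        simp only [headCandidates, ← hVU]; simp +contextual [or_imp]⟩
    · exact ⟨flipAt (del p₁ X) (q₁ - 1), fun Z => by simp [headCandidates, hlt.not_ge]⟩
  exact (Set.encard_le_encard hW).trans (encard_setOf_mem_list_le _)

theorem eq_or_eq_or_mem_outerCandidates (w : Window X Y p₁ p₂ p₃ q₃ q₂ q₁)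
    (hτ : mismatches X Y p₁ q₁ = {τ}) (hi : i ≤ p₁) (hj : q₁ ≤ j) (hX : Near Z (del i X))
    (hY : Near Z (del j Y)) :
    Z = del p₁ X ∨ Z = del q₁ Y ∨ Z ∈ outerCandidates X Y p₁ q₁ := by
  have hle := w.card_mismatches_add_add_le hi hj hX hY
  rw [hτ, Finset.card_singleton] at hle
  have hτ_mem : τ ∈ mismatches X Y i j := mismatches_subset hi hj (by simp [hτ])
  have hτ_range := (mem_mismatches.1 (hτ ▸ Finset.mem_singleton_self τ)).1
  have neτ := del_ne_del_of_mem_mismatches hτ_mem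
  rcases (mismatches X Y i p₁).eq_empty_or_nonempty with hl | hl <;>
    rcases (mismatches X Y q₁ j).eq_empty_or_nonempty with hr | hr
  · rw [w.del_eq_del_p₁ hi hl] at hX
    rw [w.del_eq_del_q₁ hj hr] at hY
    have := hX.eq_or_eq hY (a := τ) (del_ne_del_of_mem_mismatches (by simp [hτ])) fun m hm =>
      w.del_eq_del_of_notMem_mismatches (by simpa [hτ] using hm)
    tauto
  · obtain ⟨σ, hσ⟩ := Finset.card_eq_one.1 (show (mismatches X Y q₁ j).card = 1 by
      have := hr.card_pos; lia)
    have hσ_mem : σ ∈ mismatches X Y q₁ j := by simp [hσ]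
    have hσ_range := (mem_mismatches.1 hσ_mem).1
    have neσ := del_ne_del_of_mem_mismatches
      (mismatches_subset (hi.trans w.p₁_lt_q₁.le) le_rfl hσ_mem)
    have hZ := hY.eq_flipAt_or_eq_flipAt hX (by lia) neτ.symm neσ.symm
    rw [w.del_eq_del_p₁ hi hl, ← w.del_q₁_eq_flipAt hτ] at hZ
    exact .inr <| hZ.imp_right fun hZ => .inr ⟨j, σ, hσ, hZ⟩
  · obtain ⟨σ, hσ⟩ := Finset.card_eq_one.1 (show (mismatches X Y i p₁).card = 1 by
      have := hl.card_pos; lia)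
    have hσ_mem : σ ∈ mismatches X Y i p₁ := by simp [hσ]
    have hσ_range := (mem_mismatches.1 hσ_mem).1
    have neσ := del_ne_del_of_mem_mismatches
      (mismatches_subset le_rfl (w.p₁_lt_q₁.le.trans hj) hσ_mem)
    have hZ := hX.eq_flipAt_or_eq_flipAt hY (by lia) neτ neσ
    rw [w.del_eq_del_q₁ hj hr, ← w.del_p₁_eq_flipAt hτ] at hZ
    exact hZ.imp_right fun hZ => .inr (.inl ⟨i, σ, hσ, hZ⟩)
  · have := hl.card_pos; have := hr.card_pos
    lia

theorem orderedCommon_subset_candidates (w : Window X Y p₁ p₂ p₃ q₃ q₂ q₁)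
    (hM : (mismatches X Y p₂ q₂).Nonempty) (hτ : mismatches X Y p₁ q₁ = {τ}) :
    orderedCommon X Y ⊆ outerCandidates X Y p₁ q₁ ∪
      (tailCandidates X Y p₁ p₂ p₃ q₁ τ ∪ headCandidates X Y p₁ q₃ q₂ q₁ τ) := by
  intro Z hZ
  have ⟨hτ_range, hτ_ne⟩ := mem_mismatches.1 (hτ ▸ Finset.mem_singleton_self τ)
  have := w.lt_p₂; have := w.lt_q₁
  rcases w.cases_of_mem_orderedCommon hM hZ with ⟨i, j, hi, hj, hX, hY⟩ |
    (hZ | ⟨hempty, hZ⟩ | ⟨σ, hσ, hZ⟩) | (hZ | ⟨hempty, hZ⟩ | ⟨σ, hσ, hZ⟩)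
  · rcases w.eq_or_eq_or_mem_outerCandidates hτ hi hj hX hY with rfl | rfl | hZ
    · simp [tailCandidates]
    · simp [headCandidates]
    · exact .inl hZ
  · simp [tailCandidates, hZ]
  · have hlt : τ < p₃ := by
      by_contra! hle
      exact hτ_ne (mismatches_eq_empty.1 hempty τ hle hτ_range.2)
    simp [tailCandidates, hZ, hlt]
  · have hστ : mismatches X Y p₂ q₁ ⊆ _ := mismatches_subset w.lt_p₂.le le_rfl
    rw [hσ, hτ, Finset.singleton_subset_singleton] at hστ
    simp [tailCandidates, hZ, hστ, w.del_p₁_eq_flipAt hτ]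
  · simp [headCandidates, hZ]
  · have hle : q₃ ≤ τ := by
      by_contra! hlt
      exact hτ_ne (mismatches_eq_empty.1 hempty τ hτ_range.1 hlt)
    simp [headCandidates, hZ, hle]
  · have hστ : mismatches X Y p₁ q₂ ⊆ _ := mismatches_subset le_rfl w.lt_q₁.le
    rw [hσ, hτ, Finset.singleton_subset_singleton] at hστ
    simp [headCandidates, hZ, hστ, w.del_q₁_eq_flipAt hτ]

end Window

theorem flipAt_del_eq_flipAt_del {X : ℕ → Bool} {c : Bool} {p q : ℕ} (hpq : p + 1 < q)
    (hc : ∀ k, p < k → k < q → X k = c) (hp : X p ≠ c) (hq : X q ≠ c) :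
    flipAt (del q X) p = flipAt (del p X) (q - 1) := by
  refine flipAt_eq_flipAt (by lia) ?_ ?_ fun m hmp hmq => ?_
  · rwa [del_of_lt (by lia), del_of_le le_rfl, hc (p + 1) (by lia) hpq]
  · rw [del_of_lt (by lia), del_sub_one_of_lt (by lia), hc (q - 1) (by lia) (by lia)]
    exact hq.symm
  · simp only [del]
    grind

section SingletonMismatches

variable {X Y : ℕ → Bool} {p q τ s k : ℕ}

theorem apply_succ_eq_of_mismatches_eq_singleton (hX : mismatches X Y p q = {τ}) (hp : p ≤ k)
    (hq : k < q) (hk : k ≠ τ) : X (k + 1) = Y k := by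
  by_contra hne
  exact hk (Finset.mem_singleton.1 (hX ▸ mem_mismatches.2 ⟨⟨hp, hq⟩, hne⟩))

theorem ne_of_le_of_mismatches_eq_singleton (hX : mismatches X Y p q = {τ})
    (hY : mismatches Y X p q = {s}) (hτs : τ ≤ s) (hne : X p ≠ Y p) (hpk : p ≤ k) (hkτ : k ≤ τ) :
    X k ≠ Y k := by
  have hτ := (mem_mismatches.1 (hX ▸ Finset.mem_singleton_self τ)).1
  induction k, hpk using Nat.le_induction with
  | base => exact hne
  | succ k hpk ih =>
    rw [apply_succ_eq_of_mismatches_eq_singleton hX hpk (by lia) (by lia),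
      apply_succ_eq_of_mismatches_eq_singleton hY hpk (by lia) (by lia)]
    exact (ih (by lia)).symm

theorem ne_of_gt_of_mismatches_eq_singleton (hX : mismatches X Y p q = {τ})
    (hY : mismatches Y X p q = {s}) (hτs : τ ≤ s) (hne : X q ≠ Y q) (hsk : s < k) (hkq : k ≤ q) :
    X k ≠ Y k := by
  have hτ := (mem_mismatches.1 (hX ▸ Finset.mem_singleton_self τ)).1
  intro hk
  suffices ∀ m, k ≤ m → m ≤ q → X m = Y m from hne (this q hkq le_rfl)
  intro m hkm
  induction m, hkm using Nat.le_induction with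
  | base => exact fun _ => hk
  | succ m hkm ih =>
    intro hmq
    rw [apply_succ_eq_of_mismatches_eq_singleton hX (by lia) (by lia) (by lia),
      apply_succ_eq_of_mismatches_eq_singleton hY (by lia) (by lia) (by lia), ih (by lia)]

theorem const_of_mismatches_eq_singleton (hX : mismatches X Y p q = {τ})
    (hY : mismatches Y X p q = {s}) (hne : X τ ≠ Y τ) (hτk : τ ≤ k) (hks : k ≤ s) :
    X (k + 1) = X τ := by
  have ⟨hτ, hτ_ne⟩ := mem_mismatches.1 (hX ▸ Finset.mem_singleton_self τ)
  have hs := (mem_mismatches.1 (hY ▸ Finset.mem_singleton_self s)).1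
  induction k using Nat.strong_induction_on with
  | _ k ih =>
    rcases hτk.eq_or_lt with rfl | hlt
    · exact (Bool.eq_not.2 hτ_ne).trans (Bool.eq_not.2 hne).symm
    obtain ⟨k, rfl⟩ : ∃ l, k = l + 1 := ⟨k - 1, by lia⟩
    rw [apply_succ_eq_of_mismatches_eq_singleton hX (by lia) (by lia) (by lia),
      apply_succ_eq_of_mismatches_eq_singleton hY (by lia) (by lia) (by lia)]
    rcases Nat.lt_succ_iff_lt_or_eq.1 hlt with hlt | rfl
    · obtain ⟨k, rfl⟩ : ∃ l, k = l + 1 := ⟨k - 1, by lia⟩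
      exact ih k (by lia) (by lia) (by lia)
    · rfl

end SingletonMismatches

namespace Window

variable {X Y : ℕ → Bool} {p₁ p₂ p₃ q₃ q₂ q₁ τ s : ℕ}

theorem encard_candidates_le {t h : ℕ∞} (ht : (tailCandidates X Y p₁ p₂ p₃ q₁ τ).encard ≤ t)
    (hh : (headCandidates X Y p₁ q₃ q₂ q₁ τ).encard ≤ h) :
    (outerCandidates X Y p₁ q₁ ∪ (tailCandidates X Y p₁ p₂ p₃ q₁ τ ∪
      headCandidates X Y p₁ q₃ q₂ q₁ τ)).encard ≤ 2 + (t + h) :=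
  (Set.encard_union_le _ _).trans <| add_le_add encard_outerCandidates_le <|
    (Set.encard_union_le _ _).trans <| add_le_add ht hh

theorem encard_orderedCommon_le_eight (w : Window X Y p₁ p₂ p₃ q₃ q₂ q₁)
    (hM : (mismatches X Y p₂ q₂).Nonempty) (hcard : (mismatches X Y p₁ q₁).card = 1) :
    (orderedCommon X Y).encard ≤ 8 := by
  obtain ⟨τ, hτ⟩ := Finset.card_eq_one.1 hcard
  refine (Set.encard_le_encard (w.orderedCommon_subset_candidates hM hτ)).trans ?_
  exact (encard_candidates_le encard_tailCandidates_le_three encard_headCandidates_le_three).trans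
    (by norm_num)

theorem flipAt_del_q₁_eq_flipAt_del_p₁ (w : Window X Y p₁ p₂ p₃ q₃ q₂ q₁)
    (hX : mismatches X Y p₁ q₁ = {τ}) (hY : mismatches Y X p₁ q₁ = {s}) (hτs : τ ≤ s)
    (hτ : q₃ ≤ τ) (hs : s < p₃) : flipAt (del q₁ X) p₁ = flipAt (del p₁ X) (q₁ - 1) := by
  have := w.lt_p₂; have := w.lt_p₃; have := w.p₂_le_q₃; have := w.p₃_le_q₂; have := w.lt_q₁
  have ne_left : ∀ k, p₁ ≤ k → k ≤ τ → X k ≠ Y k := fun k =>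
    ne_of_le_of_mismatches_eq_singleton hX hY hτs w.ne_p₁
  have ne_right : ∀ k, s < k → k ≤ q₁ → X k ≠ Y k := fun k =>
    ne_of_gt_of_mismatches_eq_singleton hX hY hτs w.ne_q₁
  have hτ_eq : τ = p₂ := by
    have := w.of_ne_left τ (ne_left τ (by lia) le_rfl)
    lia
  have hp₂ : p₂ = p₁ + 1 := by
    have := w.of_ne_left (p₁ + 1) (ne_left _ (by lia) (by lia))
    lia
  have hs_eq : s + 1 = q₂ := by
    have := w.of_ne_right (s + 1) (ne_right _ (by lia) (by lia))
    lia
  have hq₁ : q₁ = q₂ + 1 := by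
    have := w.of_ne_right (q₂ + 1) (ne_right _ (by lia) (by lia))
    lia
  have hconst : ∀ k, p₁ < k → k < q₁ → X k = X τ := by
    intro k hk hkq
    rcases eq_or_ne k τ with rfl | hne
    · rfl
    · have := const_of_mismatches_eq_singleton hX hY (ne_left τ (by lia) le_rfl)
        (k := k - 1) (by lia) (by lia)
      rwa [Nat.sub_add_cancel (by lia)] at this
  refine flipAt_del_eq_flipAt_del (by lia) hconst ?_ ?_
  · rw [hτ_eq, hp₂, apply_succ_eq_of_mismatches_eq_singleton hX le_rfl (by lia) (by lia)]
    exact w.ne_p₁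
  · rw [← hconst q₂ (by lia) (by lia), hq₁,
      apply_succ_eq_of_mismatches_eq_singleton hX (by lia) (by lia) (by lia)]
    exact w.ne_q₂.symm

theorem encard_union_le_thirteen_of_singletons (w : Window X Y p₁ p₂ p₃ q₃ q₂ q₁)
    (hMX : (mismatches X Y p₂ q₂).Nonempty) (hMY : (mismatches Y X p₂ q₂).Nonempty)
    (hX : mismatches X Y p₁ q₁ = {τ}) (hY : mismatches Y X p₁ q₁ = {s}) (hτs : τ ≤ s) :
    (orderedCommon X Y ∪ orderedCommon Y X).encard ≤ 13 := by
  have hτ := (mem_mismatches.1 (hX ▸ Finset.mem_singleton_self τ)).1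
  have hs := (mem_mismatches.1 (hY ▸ Finset.mem_singleton_self s)).1
  have hτ_ne : X τ ≠ Y τ :=
    ne_of_le_of_mismatches_eq_singleton hX hY hτs w.ne_p₁ hτ.1 le_rfl
  have hs_ne : Y (s + 1) ≠ X (s + 1) :=
    (ne_of_gt_of_mismatches_eq_singleton hX hY hτs w.ne_q₁ (Nat.lt_succ_self s) hs.2).symm
  have tailX := w.encard_tailCandidates_le_two hX (.inr hτ_ne)
  have headY := w.symm.encard_headCandidates_le_two hY (.inr hs_ne)
  have subX := w.orderedCommon_subset_candidates hMX hX
  have subY := w.symm.orderedCommon_subset_candidates hMY hY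
  have boundX := encard_candidates_le (q₃ := q₃) (q₂ := q₂) tailX encard_headCandidates_le_three
  have boundY := encard_candidates_le (p₂ := p₂) (p₃ := p₃) encard_tailCandidates_le_three headY
  rcases lt_or_ge τ q₃ with hτ₃ | hτ₃
  · have boundX' := encard_candidates_le tailX (w.encard_headCandidates_le_two hX (.inl hτ₃))
    exact (Set.encard_union_le _ _).trans <|
      (add_le_add ((Set.encard_le_encard subX).trans boundX')
        ((Set.encard_le_encard subY).trans boundY)).trans (by norm_num)
  rcases lt_or_ge s p₃ with hs₃ | hs₃
  · refine (Set.encard_le_encard (Set.union_subset_union subX subY)).trans <|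
      (ENat.add_le_add_iff_right ENat.one_ne_top).1 <|
        (encard_union_add_one_le ⟨flipAt (del p₁ X) (q₁ - 1), ?_, ?_⟩).trans <|
          (add_le_add boundX boundY).trans (by norm_num)
    · simp [headCandidates]
    · simp [tailCandidates, w.flipAt_del_q₁_eq_flipAt_del_p₁ hX hY hτs hτ₃ hs₃]
  · have boundY' := encard_candidates_le (w.symm.encard_tailCandidates_le_two hY (.inl hs₃)) headY
    exact (Set.encard_union_le _ _).trans <|
      (add_le_add ((Set.encard_le_encard subX).trans boundX)
        ((Set.encard_le_encard subY).trans boundY')).trans (by norm_num)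

theorem encard_orderedCommon_le_six_of_two_le (w : Window X Y p₁ p₂ p₃ q₃ q₂ q₁)
    (hM : (mismatches X Y p₂ q₂).Nonempty) (hcard : 2 ≤ (mismatches X Y p₁ q₁).card) :
    (orderedCommon X Y).encard ≤ 6 := by
  rcases hcard.eq_or_lt with hcard | hcard
  · exact w.encard_orderedCommon_le_six hM hcard.symm
  · exact (w.encard_orderedCommon_le_five hM hcard).trans (by norm_num)

theorem encard_union_le_thirteen (w : Window X Y p₁ p₂ p₃ q₃ q₂ q₁)
    (hMX : (mismatches X Y p₂ q₂).Nonempty) (hMY : (mismatches Y X p₂ q₂).Nonempty)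
    (hpar : Even ((mismatches X Y p₁ q₁).card + (mismatches Y X p₁ q₁).card)) :
    (orderedCommon X Y ∪ orderedCommon Y X).encard ≤ 13 := by
  have bound_of_sum : ∀ {a b : ℕ∞}, a + b ≤ 13 → (orderedCommon X Y).encard ≤ a →
      (orderedCommon Y X).encard ≤ b → (orderedCommon X Y ∪ orderedCommon Y X).encard ≤ 13 :=
    fun hab ha hb => (Set.encard_union_le _ _).trans ((add_le_add ha hb).trans hab)
  have hposX := (hMX.mono (mismatches_subset w.lt_p₂.le w.lt_q₁.le)).card_pos
  have hposY := (hMY.mono (mismatches_subset w.lt_p₂.le w.lt_q₁.le)).card_pos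
  rcases Nat.eq_or_lt_of_le hposX with hX | hX <;> rcases Nat.eq_or_lt_of_le hposY with hY | hY
  · obtain ⟨τ, hτ⟩ := Finset.card_eq_one.1 hX.symm
    obtain ⟨s, hs⟩ := Finset.card_eq_one.1 hY.symm
    rcases le_total τ s with hle | hle
    · exact w.encard_union_le_thirteen_of_singletons hMX hMY hτ hs hle
    · rw [Set.union_comm]
      exact w.symm.encard_union_le_thirteen_of_singletons hMY hMX hs hτ hle
  · exact bound_of_sum (by norm_num) (w.encard_orderedCommon_le_eight hMX hX.symm)
      (w.symm.encard_orderedCommon_le_five hMY (by grind))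
  · exact bound_of_sum (by norm_num) (w.encard_orderedCommon_le_five hMX (by grind))
      (w.symm.encard_orderedCommon_le_eight hMY hY.symm)
  · exact bound_of_sum (by norm_num) (w.encard_orderedCommon_le_six_of_two_le hMX hX)
      (w.symm.encard_orderedCommon_le_six_of_two_le hMY hY)

end Window

/-- `X` and `Y` agree from `N` on and have the same weight and the same first moment. -/
structure Balanced (X Y : ℕ → Bool) (N : ℕ) : Prop where
  eq_of_le : ∀ k, N ≤ k → X k = Y k
  sum_eq : ∑ k ∈ Finset.range N, (X k).toInt = ∑ k ∈ Finset.range N, (Y k).toInt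
  sum_mul_eq : ∑ k ∈ Finset.range N, (k : ℤ) * (X k).toInt =
    ∑ k ∈ Finset.range N, (k : ℤ) * (Y k).toInt

/-- The entrywise difference of two binary sequences, with values in `{-1, 0, 1}`. -/
def diff (X Y : ℕ → Bool) (k : ℕ) : ℤ := (X k).toInt - (Y k).toInt

theorem toInt_mem_Icc (b : Bool) : b.toInt ∈ Set.Icc 0 1 := by cases b <;> simp

section Diff

variable {X Y : ℕ → Bool} {k p q : ℕ}

theorem diff_eq_zero_iff : diff X Y k = 0 ↔ X k = Y k := by
  unfold diff; cases X k <;> cases Y k <;> simp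

theorem diff_eq_one_or_eq_neg_one (h : X k ≠ Y k) : diff X Y k = 1 ∨ diff X Y k = -1 := by
  revert h; unfold diff; cases X k <;> cases Y k <;> simp

theorem sum_diff_of_shift (hpq : p ≤ q) (h : ∀ k, p ≤ k → k < q → X (k + 1) = Y k) :
    ∑ k ∈ Finset.Ico p (q + 1), diff X Y k = (X p).toInt - (Y q).toInt := by
  induction q, hpq using Nat.le_induction with
  | base => simp [diff]
  | succ q hpq ih =>
    rw [Finset.sum_Ico_succ_top (by lia), ih fun k hk hkq => h k hk (by lia), diff,
      h q hpq (by lia)]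
    ring

theorem sum_mul_diff_of_shift (hpq : p ≤ q) (h : ∀ k, p ≤ k → k < q → X (k + 1) = Y k) :
    ∑ k ∈ Finset.Ico p (q + 1), (k : ℤ) * diff X Y k =
      p * (X p).toInt - q * (Y q).toInt + ∑ k ∈ Finset.Ico p q, (Y k).toInt := by
  induction q, hpq using Nat.le_induction with
  | base => simp [diff, mul_sub]
  | succ q hpq ih =>
    rw [Finset.sum_Ico_succ_top (by lia), ih fun k hk hkq => h k hk (by lia), diff,
      h q hpq (by lia), Finset.sum_Ico_succ_top hpq]
    push_cast
    ring

theorem card_mismatches_eq_sum :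
    ((mismatches X Y p q).card : ℤ) =
      ∑ k ∈ Finset.Ico p q, if X (k + 1) ≠ Y k then (1 : ℤ) else 0 := by
  rw [mismatches, Finset.card_filter]
  push_cast
  rfl

-- Modulo `2`, `[a ≠ b] ≡ a - b`, so each `k` contributes `diff X Y k + diff X Y (k + 1)`.
theorem two_dvd_card_mismatches_add_sub (hpq : p ≤ q) :
    (2 : ℤ) ∣ (mismatches X Y p q).card + (mismatches Y X p q).card -
      (2 * ∑ k ∈ Finset.Ico p (q + 1), diff X Y k - diff X Y p - diff X Y q) := by
  have hsum : 2 * ∑ k ∈ Finset.Ico p (q + 1), diff X Y k - diff X Y p - diff X Y q =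
      ∑ k ∈ Finset.Ico p q, (diff X Y k + diff X Y (k + 1)) := by
    rw [Finset.sum_add_distrib, Finset.sum_Ico_add' (diff X Y)]
    linear_combination Finset.sum_Ico_succ_top hpq (diff X Y) +
      Finset.sum_eq_sum_Ico_succ_bot (Nat.lt_succ_of_le hpq) (diff X Y)
  rw [hsum, card_mismatches_eq_sum, card_mismatches_eq_sum, ← Finset.sum_add_distrib,
    ← Finset.sum_sub_distrib]
  refine Finset.dvd_sum fun k _ => ?_
  unfold diff
  generalize X k = a, X (k + 1) = b, Y k = c, Y (k + 1) = d
  revert a b c d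
  decide

theorem Window.even_card_mismatches_add {p₁ p₂ p₃ q₃ q₂ q₁ : ℕ}
    (w : Window X Y p₁ p₂ p₃ q₃ q₂ q₁) :
    Even ((mismatches X Y p₁ q₁).card + (mismatches Y X p₁ q₁).card) := by
  have hp := diff_eq_one_or_eq_neg_one w.ne_p₁
  have hq := diff_eq_one_or_eq_neg_one w.ne_q₁
  have hdvd := two_dvd_card_mismatches_add_sub (X := X) (Y := Y) w.p₁_lt_q₁.le
  rw [even_iff_two_dvd]
  lia

end Diff

namespace Balanced

variable {X Y : ℕ → Bool} {N : ℕ} {p₁ p₂ p₃ q₃ q₂ q₁ : ℕ}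

theorem symm (h : Balanced X Y N) : Balanced Y X N where
  eq_of_le k hk := (h.eq_of_le k hk).symm
  sum_eq := h.sum_eq.symm
  sum_mul_eq := h.sum_mul_eq.symm

theorem lt_of_ne (h : Balanced X Y N) {k : ℕ} (hk : X k ≠ Y k) : k < N :=
  lt_of_not_ge fun hN => hk (h.eq_of_le k hN)

theorem sum_diff (h : Balanced X Y N) : ∑ k ∈ Finset.range N, diff X Y k = 0 := by
  simp only [diff, Finset.sum_sub_distrib, h.sum_eq, sub_self]

theorem sum_mul_diff (h : Balanced X Y N) : ∑ k ∈ Finset.range N, (k : ℤ) * diff X Y k = 0 := by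
  simp only [diff, mul_sub, Finset.sum_sub_distrib, h.sum_mul_eq, sub_self]

theorem four_le_card_ne (h : Balanced X Y N) (hXY : X ≠ Y) :
    4 ≤ ((Finset.range N).filter fun k => X k ≠ Y k).card := by
  set D := (Finset.range N).filter fun k => X k ≠ Y k with hD
  have sum_D : ∑ k ∈ D, diff X Y k = 0 :=
    (Finset.sum_filter_of_ne fun k _ hk => mt diff_eq_zero_iff.2 hk).trans h.sum_diff
  have sum_mul_D : ∑ k ∈ D, (k : ℤ) * diff X Y k = 0 :=
    (Finset.sum_filter_of_ne fun k _ hk =>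
      mt diff_eq_zero_iff.2 (right_ne_zero_of_mul hk)).trans h.sum_mul_diff
  have card_pos : 0 < D.card := by
    obtain ⟨k, hk⟩ := Function.ne_iff.1 hXY
    exact Finset.card_pos.2 ⟨k, by simp [hD, hk, h.lt_of_ne hk]⟩
  have card_even : (2 : ℤ) ∣ D.card := by
    have hdvd : (2 : ℤ) ∣ ∑ k ∈ D, (diff X Y k + 1) := Finset.dvd_sum fun k hk => by
      have := diff_eq_one_or_eq_neg_one (Finset.mem_filter.1 hk).2
      lia
    simpa [Finset.sum_add_distrib, sum_D] using hdvd
  have card_ne_two : D.card ≠ 2 := by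
    intro hcard
    obtain ⟨a, b, hab, hDab⟩ := Finset.card_eq_two.1 hcard
    have hb : X b ≠ Y b := by
      have hbD : b ∈ D := by simp [hDab]
      exact (Finset.mem_filter.1 hbD).2
    rw [hDab, Finset.sum_pair hab] at sum_D sum_mul_D
    have hmul : ((b : ℤ) - a) * diff X Y b = 0 := by
      linear_combination sum_mul_D - (a : ℤ) * sum_D
    rcases mul_eq_zero.1 hmul with hba | hdiff
    · lia
    · exact hb (diff_eq_zero_iff.1 hdiff)
  lia

theorem exists_window (h : Balanced X Y N) (hXY : X ≠ Y) :
    ∃ p₁ p₂ p₃ q₃ q₂ q₁, Window X Y p₁ p₂ p₃ q₃ q₂ q₁ := by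
  set D := (Finset.range N).filter fun k => X k ≠ Y k with hD
  obtain ⟨r, hr⟩ := Nat.exists_eq_add_of_le' (h.four_le_card_ne hXY)
  let f := D.orderEmbOfFin hr
  have hf_ne : ∀ a, X (f a) ≠ Y (f a) := fun a =>
    (Finset.mem_filter.1 (D.orderEmbOfFin_mem hr a)).2
  have hf_surj : ∀ m, X m ≠ Y m → ∃ a, f a = m := fun m hm => by
    have hmem : m ∈ (D : Set ℕ) := by simp [hD, hm, h.lt_of_ne hm]
    rwa [← D.range_orderEmbOfFin hr] at hmem
  refine ⟨f ⟨0, by lia⟩, f ⟨1, by lia⟩, f ⟨2, by lia⟩, f ⟨r + 1, by lia⟩, f ⟨r + 2, by lia⟩,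
    f ⟨r + 3, by lia⟩, ?_, ?_, ?_, ?_, ?_, ?_, hf_ne _, hf_ne _, hf_ne _, hf_ne _, hf_ne _, hf_ne _,
    fun m hm => ?_, fun m hm => ?_⟩
  case refine_7 | refine_8 =>
    obtain ⟨⟨a, ha⟩, rfl⟩ := hf_surj m hm
    simp only [f.injective.eq_iff, f.le_iff_le, Fin.mk.injEq, Fin.mk_le_mk]
    lia
  all_goals
    simp only [f.lt_iff_lt, f.le_iff_le, Fin.mk_lt_mk, Fin.mk_le_mk]
    lia

theorem sum_eq_of_window (h : Balanced X Y N) (w : Window X Y p₁ p₂ p₃ q₃ q₂ q₁) {f : ℕ → ℤ}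
    (hf : ∀ k, X k = Y k → f k = 0) :
    ∑ k ∈ Finset.range N, f k = f p₁ + ∑ k ∈ Finset.Ico p₂ (q₂ + 1), f k + f q₁ := by
  have := w.lt_p₂; have := w.lt_p₃; have := w.p₃_le_q₂; have := w.lt_q₂; have := w.lt_q₁
  have hsub : insert p₁ (insert q₁ (Finset.Ico p₂ (q₂ + 1))) ⊆ Finset.range N := by
    have := h.lt_of_ne w.ne_q₁
    intro k
    simp only [Finset.mem_insert, Finset.mem_Ico, Finset.mem_range]
    lia
  rw [← Finset.sum_subset hsub, Finset.sum_insert, Finset.sum_insert]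
  · ring
  · simp only [Finset.mem_Ico]; lia
  · simp only [Finset.mem_insert, Finset.mem_Ico]; lia
  · intro k _ hk
    refine hf k (of_not_not fun hne => ?_)
    have := w.of_ne_left k hne; have := w.of_ne_right k hne
    simp only [Finset.mem_insert, Finset.mem_Ico] at hk
    lia

-- Without a mismatch, `X` restricted to `[p₂, q₂]` is `Y` shifted by one. Equal weights then force
-- the differences at `p₁` and `q₁` to cancel; these alone contribute `q₁ - p₁` to the difference of
-- the first moments, more than a shift of `[p₂, q₂]` can compensate.
theorem nonempty_mismatches (h : Balanced X Y N) (w : Window X Y p₁ p₂ p₃ q₃ q₂ q₁) :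
    (mismatches X Y p₂ q₂).Nonempty := by
  rw [Finset.nonempty_iff_ne_empty]
  intro hempty
  have shift := mismatches_eq_empty.1 hempty
  have hpq : p₂ ≤ q₂ := w.p₂_le_q₃.trans w.lt_q₂.le
  have := w.lt_p₂; have := w.lt_q₁
  have weight := h.sum_diff
  rw [h.sum_eq_of_window w fun k => diff_eq_zero_iff.2, sum_diff_of_shift hpq shift] at weight
  have moment := h.sum_mul_diff
  rw [h.sum_eq_of_window w fun k hk => by rw [diff_eq_zero_iff.2 hk, mul_zero],
    sum_mul_diff_of_shift hpq shift] at moment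
  have sum_nonneg : 0 ≤ ∑ k ∈ Finset.Ico p₂ q₂, (Y k).toInt :=
    Finset.sum_nonneg fun k _ => (toInt_mem_Icc _).1
  have sum_le : ∑ k ∈ Finset.Ico p₂ q₂, (Y k).toInt ≤ q₂ - p₂ := by
    simpa [hpq] using
      Finset.sum_le_card_nsmul (Finset.Ico p₂ q₂) _ 1 fun k _ => (toInt_mem_Icc (Y k)).2
  have hX : (X p₂).toInt = 0 ∨ (X p₂).toInt = 1 := by cases X p₂ <;> simp
  have hY : (Y q₂).toInt = 0 ∨ (Y q₂).toInt = 1 := by cases Y q₂ <;> simp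
  rcases diff_eq_one_or_eq_neg_one w.ne_p₁ with hp | hp <;>
    rcases diff_eq_one_or_eq_neg_one w.ne_q₁ with hq | hq <;>
    rcases hX with hX | hX <;> rcases hY with hY | hY <;>
    rw [hp, hq, hX, hY] at weight moment <;> lia

theorem encard_union_le_thirteen (h : Balanced X Y N) (hXY : X ≠ Y) :
    (orderedCommon X Y ∪ orderedCommon Y X).encard ≤ 13 := by
  obtain ⟨p₁, p₂, p₃, q₃, q₂, q₁, w⟩ := h.exists_window hXY
  exact w.encard_union_le_thirteen (h.nonempty_mismatches w) (h.symm.nonempty_mismatches w.symm)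
    (w.even_card_mismatches_add)

end Balanced

section Syndromes

variable {X Y Z W : ℕ → Bool} {i j k m : ℕ}

theorem sum_range_del (h : i ≤ m) :
    ∑ l ∈ Finset.range m, (del i X l).toInt =
      ∑ l ∈ Finset.range (m + 1), (X l).toInt - (X i).toInt := by
  induction m, h using Nat.le_induction with
  | base =>
    rw [Finset.sum_range_succ, add_sub_cancel_right]
    exact Finset.sum_congr rfl fun l hl => by rw [del_of_lt (Finset.mem_range.1 hl)]
  | succ m hm ih =>
    rw [Finset.sum_range_succ, ih, del_of_le hm, Finset.sum_range_succ _ (m + 1)]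
    ring

theorem sum_range_mul_del (h : i ≤ m) :
    ∑ l ∈ Finset.range m, (l : ℤ) * (del i X l).toInt =
      ∑ l ∈ Finset.range (m + 1), (l : ℤ) * (X l).toInt -
        (i * (X i).toInt + ∑ l ∈ Finset.Ico (i + 1) (m + 1), (X l).toInt) := by
  induction m, h using Nat.le_induction with
  | base =>
    rw [Finset.sum_range_succ, Finset.Ico_self, Finset.sum_empty, add_zero, add_sub_cancel_right]
    exact Finset.sum_congr rfl fun l hl => by rw [del_of_lt (Finset.mem_range.1 hl)]
  | succ m hm ih =>
    rw [Finset.sum_range_succ, ih, del_of_le hm, Finset.sum_range_succ _ (m + 1),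
      Finset.sum_Ico_succ_top (Nat.succ_le_succ hm)]
    push_cast
    ring

theorem mul_toInt_add_sum_Ico_mem_Icc (h : i ≤ m) :
    i * (X i).toInt + ∑ l ∈ Finset.Ico (i + 1) (m + 1), (X l).toInt ∈ Set.Icc (0 : ℤ) m := by
  have sum_nonneg : 0 ≤ ∑ l ∈ Finset.Ico (i + 1) (m + 1), (X l).toInt :=
    Finset.sum_nonneg fun l _ => (toInt_mem_Icc _).1
  have sum_le : ∑ l ∈ Finset.Ico (i + 1) (m + 1), (X l).toInt ≤ m - i := by
    simpa [h] using
      Finset.sum_le_card_nsmul (Finset.Ico (i + 1) (m + 1)) _ 1 fun l _ => (toInt_mem_Icc (X l)).2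
  rw [Set.mem_Icc]
  cases X i <;> simp <;> lia

theorem Near.sum_range_eq_add (h : Near Z W) (m : ℕ) :
    ∃ t ∈ Set.Icc (0 : ℤ) m, ∃ δ ∈ Set.Icc (-1 : ℤ) 1,
      ∑ l ∈ Finset.range m, (Z l).toInt = ∑ l ∈ Finset.range m, (W l).toInt + δ ∧
      ∑ l ∈ Finset.range m, (l : ℤ) * (Z l).toInt =
        ∑ l ∈ Finset.range m, (l : ℤ) * (W l).toInt + t * δ := by
  obtain ⟨t, ht⟩ := h
  have diff_eq_zero : ∀ l, l ≠ t → diff Z W l = 0 := fun l hl => diff_eq_zero_iff.2 (ht l hl)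
  have sum_diff : ∀ c : ℕ → ℤ, ∑ l ∈ Finset.range m, c l * (Z l).toInt =
      ∑ l ∈ Finset.range m, c l * (W l).toInt + if t < m then c t * diff Z W t else 0 := by
    intro c
    rw [← sub_eq_iff_eq_add', ← Finset.sum_sub_distrib]
    convert Finset.sum_eq_ite (s := Finset.range m) (f := fun l => c l * diff Z W l) t
      fun l _ hl => by rw [diff_eq_zero l hl, mul_zero] using 1
    · simp only [diff, mul_sub]
    · simp only [Finset.mem_range]
  have weight := sum_diff fun _ => 1
  simp only [one_mul] at weight
  rcases lt_or_ge t m with htm | htm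
  · simp only [htm, if_true] at weight sum_diff
    refine ⟨t, by simp [htm.le], diff Z W t, ?_, weight, sum_diff _⟩
    unfold diff
    cases Z t <;> cases W t <;> simp
  · simp only [htm.not_gt, if_false] at weight sum_diff
    exact ⟨0, by simp, 0, by simp, weight, by simpa using sum_diff (fun l => l)⟩

theorem abs_mul_sub_mul_le {s t δ ε K : ℤ} (hs : s ∈ Set.Icc 0 K) (ht : t ∈ Set.Icc 0 K)
    (hδ : δ ∈ Set.Icc (-1) 1) (hε : ε ∈ Set.Icc (-1) 1) (hδε : |δ - ε| ≤ 1) :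
    |t * δ - s * ε| ≤ K := by
  obtain ⟨hδ₁, hδ₂⟩ := hδ
  obtain ⟨hε₁, hε₂⟩ := hε
  obtain ⟨hs₁, hs₂⟩ := hs
  obtain ⟨ht₁, ht₂⟩ := ht
  rw [abs_le] at hδε ⊢
  interval_cases δ <;> interval_cases ε <;> lia

/-- Sequences of length `k + 1` with a common neighbour have weights differing by at most `3` and,
once the weights agree, first moments differing by at most `2 * k`; so congruent syndromes
coincide. -/
theorem balanced_of_modEq (hX : ∀ m, k + 1 ≤ m → X m = false) (hY : ∀ m, k + 1 ≤ m → Y m = false)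
    (hi : i ≤ k) (hj : j ≤ k) (hZX : Near Z (del i X)) (hZY : Near Z (del j Y))
    (h₀ : ∑ l ∈ Finset.range (k + 1), (X l).toInt ≡
      ∑ l ∈ Finset.range (k + 1), (Y l).toInt [ZMOD 4])
    (h₁ : ∑ l ∈ Finset.range (k + 1), ((l : ℤ) + 1) * (X l).toInt ≡
      ∑ l ∈ Finset.range (k + 1), ((l : ℤ) + 1) * (Y l).toInt [ZMOD 2 * (k + 1)]) :
    Balanced X Y (k + 1) := by
  obtain ⟨t, ht, δ, hδ, weightX, momentX⟩ := hZX.sum_range_eq_add k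
  obtain ⟨s, hs, ε, hε, weightY, momentY⟩ := hZY.sum_range_eq_add k
  rw [sum_range_del hi] at weightX
  rw [sum_range_del hj] at weightY
  rw [sum_range_mul_del hi] at momentX
  rw [sum_range_mul_del hj] at momentY
  have hXi := toInt_mem_Icc (X i)
  have hYj := toInt_mem_Icc (Y j)
  have weight_eq : ∑ l ∈ Finset.range (k + 1), (X l).toInt =
      ∑ l ∈ Finset.range (k + 1), (Y l).toInt := by
    have := h₀.dvd
    simp only [Set.mem_Icc] at *
    lia
  have hδε : |δ - ε| ≤ 1 := by
    rw [abs_le]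
    simp only [Set.mem_Icc] at *
    lia
  have hsub := abs_le.1 (abs_mul_sub_mul_le hs ht hδ hε hδε)
  have hXm := mul_toInt_add_sum_Ico_mem_Icc (X := X) hi
  have hYm := mul_toInt_add_sum_Ico_mem_Icc (X := Y) hj
  have hdvd := h₁.symm.dvd
  simp only [add_mul, one_mul, Finset.sum_add_distrib, weight_eq, add_sub_add_right_eq_sub] at hdvd
  have moment_eq := Int.eq_zero_of_abs_lt_dvd hdvd <| abs_lt.2 <| by
    simp only [Set.mem_Icc] at hXm hYm
    constructor <;> linarith
  exact ⟨fun m hm => by rw [hX m hm, hY m hm], weight_eq, sub_eq_zero.1 moment_eq⟩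

end Syndromes

section Extend

variable {n k : ℕ}

/-- The infinite binary sequence continuing `x` by zeros, with entries read as truth values; it puts
`x` and its shorter subsequences into one type. -/
def extend (x : BinSeq n) : ℕ → Bool := fun m =>
  if h : m < n then decide (x ⟨m, h⟩ = 1) else false

theorem extend_apply (x : BinSeq n) (i : Fin n) : extend x i = decide (x i = 1) := by
  simp [extend]

theorem extend_of_le (x : BinSeq n) {m : ℕ} (h : n ≤ m) : extend x m = false := by
  simp [extend, h]

theorem toInt_extend (x : BinSeq n) (i : Fin n) : (extend x i).toInt = ((x i : ℕ) : ℤ) := by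
  rw [extend_apply]
  generalize x i = a
  revert a
  decide

theorem extend_injective : Function.Injective (extend (n := n)) := by
  intro x y h
  funext i
  have hi : (extend x i).toInt = (extend y i).toInt := by rw [h]
  rw [toInt_extend, toInt_extend] at hi
  exact Fin.ext (by exact_mod_cast hi)

theorem exists_eq_succAbove_of_strictMono {f : Fin k → Fin (k + 1)} (hf : StrictMono f) :
    ∃ i : Fin (k + 1), f = i.succAbove := by
  obtain ⟨i, hi⟩ : ∃ i, ∀ a, f a ≠ i := by
    have hsurj : ¬ Function.Surjective f := fun h => by
      simpa using Fintype.card_le_of_surjective f h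
    simpa [Function.Surjective] using hsurj
  refine ⟨i, (Finset.orderEmbOfFin_unique (s := {i}ᶜ) (by simp [Finset.card_compl])
    (fun a => by simpa using hi a) hf).trans ?_⟩
  rw [Finset.orderEmbOfFin_compl_singleton_eq_succAboveOrderEmb]
  rfl

theorem extend_comp_succAbove (x : BinSeq (k + 1)) (i : Fin (k + 1)) :
    extend (n := k) (x ∘ i.succAbove) = del i (extend x) := by
  funext m
  rcases lt_or_ge m k with hm | hm
  · have happly : extend (n := k) (x ∘ i.succAbove) m = extend x (i.succAbove ⟨m, hm⟩) := by
      rw [extend_apply]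
      exact extend_apply (n := k) _ ⟨m, hm⟩
    rw [happly]
    rcases lt_or_ge m i with hi | hi
    · rw [del_of_lt hi, Fin.succAbove_of_castSucc_lt _ _ hi]
      rfl
    · rw [del_of_le hi, Fin.succAbove_of_le_castSucc _ _ hi]
      rfl
  · rw [del_of_le (by lia), extend_of_le _ hm, extend_of_le _ (by lia)]

theorem near_extend_of_mem_substitutionBall {y z : BinSeq k} (h : z ∈ substitutionBall y) :
    Near (extend z) (extend y) := by
  have hcard : (Finset.univ.filter fun i => y i ≠ z i).card ≤ 1 := h
  rcases isEmpty_or_nonempty (Fin k) with _ | _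
  · exact ⟨0, fun m _ => by rw [Subsingleton.elim z y]⟩
  obtain ⟨t, ht⟩ := Finset.card_le_one_iff_subset_singleton.1 hcard
  refine ⟨t, fun m hm => ?_⟩
  by_cases hmk : m < k
  · have hyz : y ⟨m, hmk⟩ = z ⟨m, hmk⟩ := by
      by_contra hne
      have hmem := ht (Finset.mem_filter.2 ⟨Finset.mem_univ _, hne⟩)
      exact hm (congrArg Fin.val (Finset.mem_singleton.1 hmem))
    simp only [extend, hmk, hyz]
  · rw [extend_of_le _ (by lia), extend_of_le _ (by lia)]

theorem exists_near_del_of_mem_delSubBall {x : BinSeq (k + 1)} {z : BinSeq k}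
    (h : z ∈ delSubBall x) : ∃ i ≤ k, Near (extend z) (del i (extend x)) := by
  obtain ⟨y, ⟨f, hf, rfl⟩, hz⟩ := h
  obtain ⟨i, rfl⟩ := exists_eq_succAbove_of_strictMono (k := k) hf
  refine ⟨i, i.is_le, ?_⟩
  rw [← extend_comp_succAbove]
  exact near_extend_of_mem_substitutionBall hz

theorem extend_mem_orderedCommon_union {x y : BinSeq (k + 1)} {z : BinSeq k}
    (hx : z ∈ delSubBall x) (hy : z ∈ delSubBall y) :
    extend z ∈ orderedCommon (extend x) (extend y) ∪ orderedCommon (extend y) (extend x) := by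
  obtain ⟨i, -, hi⟩ := exists_near_del_of_mem_delSubBall hx
  obtain ⟨j, -, hj⟩ := exists_near_del_of_mem_delSubBall hy
  exact (le_total i j).imp (fun hij => ⟨i, j, hij, hi, hj⟩) fun hji => ⟨j, i, hji, hj, hi⟩

theorem sum_mul_extend (x : BinSeq n) (c : ℕ → ℤ) :
    ∑ l ∈ Finset.range n, c l * (extend x l).toInt = ∑ i : Fin n, c i * ((x i : ℕ) : ℤ) := by
  rw [← Fin.sum_univ_eq_sum_range fun l => c l * (extend x l).toInt]
  simp only [toInt_extend]

theorem vtSyndrome_zero_eq_sum_extend (x : BinSeq n) :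
    (vtSyndrome 0 x : ℤ) = ∑ l ∈ Finset.range n, (extend x l).toInt := by
  simpa [vtSyndrome, weight] using (sum_mul_extend x fun _ => 1).symm

theorem vtSyndrome_one_eq_sum_extend (x : BinSeq n) :
    (vtSyndrome 1 x : ℤ) = ∑ l ∈ Finset.range n, ((l : ℤ) + 1) * (extend x l).toInt := by
  rw [sum_mul_extend x fun l => (l : ℤ) + 1]
  simp [vtSyndrome]

end Extend

theorem balanced_extend_of_mem_codeC1 {k s₀ s₁ : ℕ} {x y : BinSeq (k + 1)} {z : BinSeq k}
    (hx : x ∈ codeC1 (k + 1) s₀ s₁) (hy : y ∈ codeC1 (k + 1) s₀ s₁) (hzx : z ∈ delSubBall x)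
    (hzy : z ∈ delSubBall y) : Balanced (extend x) (extend y) (k + 1) := by
  have weight_modEq := Int.natCast_modEq_iff.2 (hx.1.trans hy.1.symm)
  have moment_modEq := Int.natCast_modEq_iff.2 (hx.2.trans hy.2.symm)
  rw [vtSyndrome_zero_eq_sum_extend, vtSyndrome_zero_eq_sum_extend] at weight_modEq
  rw [vtSyndrome_one_eq_sum_extend, vtSyndrome_one_eq_sum_extend] at moment_modEq
  obtain ⟨i, hi, hzi⟩ := exists_near_del_of_mem_delSubBall hzx
  obtain ⟨j, hj, hzj⟩ := exists_near_del_of_mem_delSubBall hzy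
  exact balanced_of_modEq (fun m => extend_of_le x) (fun m => extend_of_le y) hi hj hzi hzj
    weight_modEq (by exact_mod_cast moment_modEq)

theorem isReconstructionCode_codeC1 (n s₀ s₁ : ℕ) : IsReconstructionCode 14 (codeC1 n s₀ s₁) := by
  intro x hx y hy hxy
  rcases n with _ | k
  · exact (hxy (Subsingleton.elim x y)).elim
  rcases (delSubBall x ∩ delSubBall y).eq_empty_or_nonempty with hempty | ⟨z, hzx, hzy⟩
  · simp [hempty]
  have balanced := balanced_extend_of_mem_codeC1 hx hy hzx hzy
  have hsub : extend '' (delSubBall x ∩ delSubBall y) ⊆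
      orderedCommon (extend x) (extend y) ∪ orderedCommon (extend y) (extend x) := by
    rintro _ ⟨z, ⟨hzx, hzy⟩, rfl⟩
    exact extend_mem_orderedCommon_union hzx hzy
  have hle : (delSubBall x ∩ delSubBall y).encard ≤ 13 := by
    rw [← extend_injective.encard_image]
    exact (Set.encard_le_encard hsub).trans
      (balanced.encard_union_le_thirteen (extend_injective.ne hxy))
  rw [← (Set.toFinite _).cast_ncard_eq] at hle
  exact Nat.lt_succ_of_le (by exact_mod_cast hle)

theorem exists_two_pow_div_le_ncard_codeC1 {n : ℕ} (hn : 1 ≤ n) :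
    ∃ s₀ < 4, ∃ s₁ < 2 * n, (2 : ℝ) ^ n / (8 * n) ≤ (codeC1 n s₀ s₁).ncard := by
  obtain ⟨⟨s₀, s₁⟩, hs, hcard⟩ := Finset.exists_le_card_fiber_of_nsmul_le_card_of_maps_to
    (s := (Finset.univ : Finset (BinSeq n))) (t := Finset.range 4 ×ˢ Finset.range (2 * n))
    (f := fun x => (vtSyndrome 0 x % 4, vtSyndrome 1 x % (2 * n))) (b := (2 : ℝ) ^ n / (8 * n))
    (fun x _ => by simpa using ⟨Nat.mod_lt _ (by lia), Nat.mod_lt _ (by lia)⟩)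
    ⟨(0, 0), by simpa using Nat.succ_le_iff.1 hn⟩
    (by
      simp only [Finset.card_product, Finset.card_range, Finset.card_univ, Fintype.card_fun,
        Fintype.card_fin, nsmul_eq_mul]
      push_cast
      field_simp
      norm_num)
  obtain ⟨hs₀, hs₁⟩ : s₀ < 4 ∧ s₁ < 2 * n := by simpa using hs
  refine ⟨s₀, hs₀, s₁, hs₁, hcard.trans ?_⟩
  rw [← Set.ncard_coe_finset]
  refine Nat.cast_le.2 (Set.ncard_le_ncard (fun x hx => ?_) (Set.toFinite _))
  obtain ⟨hx₀, hx₁⟩ : vtSyndrome 0 x % 4 = s₀ ∧ vtSyndrome 1 x % (2 * n) = s₁ := by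
    simpa using hx
  exact ⟨hx₀.trans (Nat.mod_eq_of_lt hs₀).symm, hx₁.trans (Nat.mod_eq_of_lt hs₁).symm⟩

theorem redundancy_le_logb {n : ℕ} {C : Set (BinSeq n)} {b : ℝ} (hb : 0 < b)
    (h : 2 ^ n / b ≤ C.ncard) : redundancy C ≤ Real.logb 2 b := by
  have hle := Real.logb_le_logb_of_le one_lt_two (by positivity) h
  rw [Real.logb_div (by positivity) hb.ne', Real.logb_pow, Real.logb_self_eq_one one_lt_two,
    mul_one] at hle
  rw [redundancy]
  linarith

end DelSub

theorem theorem5 (n : ℕ) (hn : 1 ≤ n) :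
    (∀ s₀ ∈ Finset.Icc 0 3, ∀ s₁ ∈ Finset.Icc 0 (2 * n - 1),
      DelSub.IsReconstructionCode 14 (DelSub.codeC1 n s₀ s₁)) ∧
    ∃ s₀ ∈ Finset.Icc 0 3, ∃ s₁ ∈ Finset.Icc 0 (2 * n - 1),
      (DelSub.codeC1 n s₀ s₁).Nonempty ∧
      DelSub.redundancy (DelSub.codeC1 n s₀ s₁) ≤ Real.logb 2 (n : ℝ) + 3 := by
  refine ⟨fun s₀ _ s₁ _ => DelSub.isReconstructionCode_codeC1 n s₀ s₁, ?_⟩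
  have hn₀ : (0 : ℝ) < n := by exact_mod_cast hn
  obtain ⟨s₀, hs₀, s₁, hs₁, hcard⟩ := DelSub.exists_two_pow_div_le_ncard_codeC1 hn
  refine ⟨s₀, Finset.mem_Icc.2 (by lia), s₁, Finset.mem_Icc.2 (by lia), ?_, ?_⟩
  · have hpos : (0 : ℝ) < (DelSub.codeC1 n s₀ s₁).ncard := lt_of_lt_of_le (by positivity) hcard
    exact Set.nonempty_of_ncard_ne_zero (by exact_mod_cast hpos.ne')
  · calc DelSub.redundancy (DelSub.codeC1 n s₀ s₁)
        ≤ Real.logb 2 (8 * n) := DelSub.redundancy_le_logb (by positivity) hcard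
      _ = Real.logb 2 n + 3 := by
        rw [show (8 : ℝ) = 2 ^ 3 by norm_num, Real.logb_mul (by positivity) hn₀.ne',
          Real.logb_pow, Real.logb_self_eq_one one_lt_two]
        norm_num [add_comm]
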